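/- Let $n\ge 1$ and let $\psi\in C^\infty(\mathbb R^n;\mathbb R)$ be a smooth cut-off function, that is, $\operatorname{supp}\psi\subset\{|\xi|\le 2\}$ and $\psi=1$ in a neighbourhood of $0$. Put $\varphi=\psi-\psi(2\,\cdot)$, $\psi_0=\psi$, $\psi_k=\varphi(2^{-k}\cdot)$ for $k\ge 1$, and $\Delta_k=\mathcal F^{-1}\psi_k\mathcal F$ for $k\ge 0$. For $\sigma\in\mathbb R$, $0<r,t\le\infty$ and a tempered distribution $u$ on $\mathbb R^n$ let $$\|u\|_{B^{\sigma}_{r,t}}=\Big(\sum_{k=0}^{\infty}2^{k\sigma t}\|\Delta_k u\|_{L^r(\mathbb R^n)}^t\Big)^{1/t}\quad(t<\infty),\qquad \|u\|_{B^{\sigma}_{r,\infty}}=\sup_{k\ge0}2^{k\sigma}\|\Delta_k u\|_{L^r(\mathbb R^n)},$$ and let $B^\sigma_{r,t}$ be the set of all tempered distributions $u$ for which this is finite. **Theorem 4.1.** Let $0<q<\infty$, $0<p,p_0,p_1\le\infty$, $0<\theta<1$, $s,s_0,s_1\in\mathbb R$, and suppose that (with $n/\infty=0$) $$\frac np-s=(1-\theta)\Big(\frac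 n{p_0}-s_0\Big)+\theta\Big(\frac n{p_1}-s_1\Big),\qquad s_0-\frac n{p_0}\ne s_1-\frac n{p_1},\qquad s\le(1-\theta)s_0+\theta s_1,$$ and that $p_0=p_1$ if $s=(1-\theta)s_0+\theta s_1$. Then there is a constant $C$, independent of $u$, such that every $u\in B^{s_0}_{p_0,\infty}\cap B^{s_1}_{p_1,\infty}$ belongs to $B^s_{p,q}$ and satisfies $$\|u\|_{B^s_{p,q}}\le C\,\|u\|_{B^{s_0}_{p_0,\infty}}^{1-\theta}\,\|u\|_{B^{s_1}_{p_1,\infty}}^{\theta}.$$ -/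

import Mathlib

open MeasureTheory Topology
open scoped ENNReal NNReal SchwartzMap

noncomputable section

namespace Besov

/-- Smooth cut-off function on `ℝⁿ`: supported in `{ξ : |ξ| ≤ 2}` and equal to `1` near the
origin. -/
structure IsCutoff {n : ℕ} (ψ : EuclideanSpace ℝ (Fin n) → ℝ) : Prop where
  smooth : ContDiff ℝ ((⊤ : ℕ∞) : WithTop ℕ∞) ψ
  support_subset : Function.support ψ ⊆ Metric.closedBall 0 2
  eventually_eq_one : ∀ᶠ ξ in 𝓝 0, ψ ξ = 1

/-- The inhomogeneous dyadic partition of unity generated by `ψ`: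
`ψ₀ = ψ` and `ψₖ(ξ) = φ(2⁻ᵏ ξ)` for `k ≥ 1`, where `φ(ξ) = ψ(ξ) - ψ(2ξ)`. -/
def dyadic {n : ℕ} (ψ : EuclideanSpace ℝ (Fin n) → ℝ) (k : ℕ) (ξ : EuclideanSpace ℝ (Fin n)) : ℝ :=
  if k = 0 then ψ ξ
  else ψ (((2 : ℝ) ^ k)⁻¹ • ξ) - ψ ((2 : ℝ) • ((2 : ℝ) ^ k)⁻¹ • ξ)

/-- The Littlewood-Paley block `Δₖ f = 𝓕⁻¹ ψₖ 𝓕 f` of a tempered distribution `f`. -/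
def block {n : ℕ} (ψ : EuclideanSpace ℝ (Fin n) → ℝ) (k : ℕ)
    (f : 𝓢'(EuclideanSpace ℝ (Fin n), ℂ)) : 𝓢'(EuclideanSpace ℝ (Fin n), ℂ) :=
  TemperedDistribution.fourierMultiplierCLM ℂ (fun ξ ↦ (dyadic ψ k ξ : ℂ)) f

/-- The tempered distribution `T` is the function `g`: the function `g` is tempered, that is
`∫ |g(x)| (1 + |x|)⁻ᴺ dx < ∞` for some `N`, and `T(χ) = ∫ χ g` for all Schwartz functions `χ`. -/
def IsGivenBy {n : ℕ} (T : 𝓢'(EuclideanSpace ℝ (Fin n), ℂ))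
    (g : EuclideanSpace ℝ (Fin n) → ℂ) : Prop :=
  (∃ N : ℕ, Integrable (fun x ↦ ((1 + ‖x‖) ^ N)⁻¹ • g x)) ∧
    ∀ χ : 𝓢(EuclideanSpace ℝ (Fin n), ℂ), T χ = ∫ x, χ x * g x

/-- The `L^p` (quasi-)norm of a tempered distribution, `0 < p ≤ ∞`. It is `‖g‖_p` if `T` is a
function `g` (which is then unique up to null sets), and `∞` if `T` is not a function. -/
def distLpNorm {n : ℕ} (p : ℝ≥0∞) (T : 𝓢'(EuclideanSpace ℝ (Fin n), ℂ)) : ℝ≥0∞ :=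
  ⨅ (g : EuclideanSpace ℝ (Fin n) → ℂ) (_ : IsGivenBy T g), eLpNorm g p volume

/-- The (quasi-)norm of the inhomogeneous Besov space `B^s_{p,q}(ℝⁿ)`, `0 < p, q ≤ ∞`, with the
supremum over `k` in place of the sum if `q = ∞`. -/
def besovNorm {n : ℕ} (ψ : EuclideanSpace ℝ (Fin n) → ℝ) (s : ℝ) (p q : ℝ≥0∞)
    (f : 𝓢'(EuclideanSpace ℝ (Fin n), ℂ)) : ℝ≥0∞ :=
  if q = ∞ then ⨆ k : ℕ, (2 : ℝ≥0∞) ^ ((k : ℝ) * s) * distLpNorm p (block ψ k f)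
  else (∑' k : ℕ, ((2 : ℝ≥0∞) ^ ((k : ℝ) * s) * distLpNorm p (block ψ k f)) ^ q.toReal) ^
    (1 / q.toReal)

/-- Membership in the inhomogeneous Besov space `B^s_{p,q}(ℝⁿ)`. -/
def MemBesov {n : ℕ} (ψ : EuclideanSpace ℝ (Fin n) → ℝ) (s : ℝ) (p q : ℝ≥0∞)
    (f : 𝓢'(EuclideanSpace ℝ (Fin n), ℂ)) : Prop :=
  besovNorm ψ s p q f < ∞

end Besov

end

/-! Let `a` and `b` be the norms of `u` in the two given spaces and `δ = (s₁ - n/p₁) - (s₀ - n/p₀)`.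
For `η` near `θ`, Hölder between `L^{p₀}` and `L^{p₁}`, followed by Bernstein's inequality, bounds
`2^{ks} ‖Δₖ u‖_p` by `C a^{1-η} b^η 2^{-k(η-θ)δ}` (`IsCutoff.exists_weighted_block_le`); by the
scaling relation the exponent of `2` vanishes at `η = θ`. Take `η = θ ± ε`. As `δ ≠ 0`, one bound
decays in `k` and the other grows. Their minimum is `C a^{1-θ} b^θ` times a sequence falling off
geometrically on both sides of the crossing point, so its `ℓ^q` norm is bounded for every finite
`q`, wherever the crossing lies (`exists_tsum_rpow_le`). Bernstein requires the Hölder exponent to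
be at most `p` for both `η`: a strict inequality for `s` leaves room, and equality forces `p₀ = p₁`,
when the exponent does not depend on `η`. Bernstein rests on the reproducing formula `g = g * K`
with a Schwartz kernel `K`. For `r ≤ 1` one splits `|g| = |g|^{1-r} |g|^r` and absorbs the supremum,
which must first be known to be finite. Since `g` is only tempered, this is obtained with weights
`(1 + δ|x|)^{-N}` and bounds uniform in the weight parameter `δ`. -/

namespace Besov

/-! ### Hölder interpolation and summation of two geometric bounds -/

/-- Interpolation of `L^p` quasi-norms: Hölder's inequality with `r⁻¹ = (1 - η) p⁻¹ + η q⁻¹`. -/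
theorem eLpNorm_le_rpow_mul_rpow {α F : Type*} [MeasurableSpace α] {μ : Measure α}
    [NormedAddCommGroup F] {f : α → F} (hf : AEStronglyMeasurable f μ) {p q r : ℝ≥0∞} {η : ℝ}
    (hη₀ : 0 ≤ η) (hη₁ : η ≤ 1)
    (h : r⁻¹ = ENNReal.ofReal (1 - η) * p⁻¹ + ENNReal.ofReal η * q⁻¹) :
    eLpNorm f r μ ≤ eLpNorm f p μ ^ (1 - η) * eLpNorm f q μ ^ η := by
  rcases hη₀.eq_or_lt with rfl | hη₀
  · have : r = p := by simpa using h
    simp [this]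
  rcases hη₁.eq_or_lt with rfl | hη₁
  · have : r = q := by simpa using h
    simp [this]
  have h1 : 0 < 1 - η := by linarith
  have key : ∀ (t : ℝ≥0∞) (a : ℝ), 0 < a → t / ENNReal.ofReal a * ENNReal.ofReal a = t := by
    intro t a ha
    exact ENNReal.div_mul_cancel (by simpa using ha) (by simp)
  have inv : ∀ (t : ℝ≥0∞) (a : ℝ), 0 < a →
      (t / ENNReal.ofReal a)⁻¹ = ENNReal.ofReal a * t⁻¹ := by
    intro t a ha
    rw [ENNReal.inv_div (by simp) (by left; simpa using ha), div_eq_mul_inv]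
  have : ENNReal.HolderTriple (p / ENNReal.ofReal (1 - η)) (q / ENNReal.ofReal η) r :=
    ⟨by rw [inv _ _ h1, inv _ _ hη₀, h]⟩
  have := eLpNorm_smul_le_mul_eLpNorm (p := p / ENNReal.ofReal (1 - η))
    (q := q / ENNReal.ofReal η) (r := r) (μ := μ) (f := fun x ↦ ‖f x‖ ^ η)
    (φ := fun x ↦ ‖f x‖ ^ (1 - η))
    (hf.norm.aemeasurable.pow_const _).aestronglyMeasurable
    (hf.norm.aemeasurable.pow_const _).aestronglyMeasurable
  rw [eLpNorm_norm_rpow _ h1, eLpNorm_norm_rpow _ hη₀, key _ _ h1, key _ _ hη₀] at this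
  refine le_trans (le_of_eq ?_) this
  rw [← eLpNorm_norm]
  congr 1
  ext x
  simp only [Pi.smul_apply', smul_eq_mul]
  rw [← Real.rpow_add' (norm_nonneg _) (by simp)]
  simp

/-- A geometric sequence truncated at its crossing of `1` has a sum bounded independently of the
position of the crossing. -/
theorem exists_tsum_min_geometric_le {ρ : ℝ} (hρ : 0 < ρ) (hρ₁ : ρ ≠ 1) :
    ∃ S : ℝ≥0, ∀ R : ℝ, 0 < R →
      ∑' k : ℕ, ENNReal.ofReal (min (R * ρ ^ k) (R * ρ ^ k)⁻¹) ≤ S := by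
  set σ : ℝ := Real.exp (-|Real.log ρ|) with hσ
  have hl : Real.log ρ ≠ 0 := by
    have := Real.log_ne_zero_of_pos_of_ne_one hρ hρ₁
    exact this
  have hσ0 : 0 < σ := Real.exp_pos _
  have hσ1 : σ < 1 := by
    rw [hσ, Real.exp_lt_one_iff]
    simpa using hl
  have hsum : Summable (fun m : ℤ ↦ σ ^ m.natAbs) := by
    refine Summable.of_nat_of_neg ?_ ?_ <;>
    simpa using summable_geometric_of_lt_one hσ0.le hσ1
  have hfin : ∑' m : ℤ, ENNReal.ofReal (σ⁻¹ * σ ^ m.natAbs) ≠ ∞ :=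
    (hsum.mul_left σ⁻¹).tsum_ofReal_ne_top
  refine ⟨(∑' m : ℤ, ENNReal.ofReal (σ⁻¹ * σ ^ m.natAbs)).toNNReal, fun R hR ↦ ?_⟩
  rw [ENNReal.coe_toNNReal hfin]
  -- Since `R ρ^k = ρ^(k+t)`, the minimum is `σ^|k+t|`. Replacing `t` by `⌊t⌋` embeds the sum in a
  -- fixed two-sided series over `ℤ`; the rounding moves the exponent by at most `1`, whence the
  -- factor `σ⁻¹`.
  set t : ℝ := Real.log R / Real.log ρ with ht
  refine le_trans ?_ (ENNReal.tsum_comp_le_tsum_of_injective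
    (f := fun k : ℕ ↦ (k : ℤ) + ⌊t⌋) (fun a b h ↦ by simpa using h)
    (fun m : ℤ ↦ ENNReal.ofReal (σ⁻¹ * σ ^ m.natAbs)))
  refine ENNReal.tsum_le_tsum fun k ↦ ENNReal.ofReal_le_ofReal ?_
  have hRe : R * ρ ^ k = Real.exp ((k + t) * Real.log ρ) := by
    rw [ht, add_mul, div_mul_cancel₀ _ hl, Real.exp_add, Real.exp_log hR, mul_comm,
      mul_comm (k : ℝ), Real.exp_mul, Real.exp_log hρ, Real.rpow_natCast]
  have hneg : ∀ y : ℝ, min y (-y) = -|y| := by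
    intro y
    rcases abs_cases y with h | h <;> rw [h.1] <;> simp <;> linarith
  have hmin : min (R * ρ ^ k) (R * ρ ^ k)⁻¹ = Real.exp (-(|k + t| * |Real.log ρ|)) := by
    rw [hRe, ← Real.exp_neg, ← abs_mul, ← Real.exp_monotone.map_min, hneg]
  rw [hmin, hσ, ← Real.exp_neg, ← Real.exp_nat_mul, ← Real.exp_add, neg_neg]
  refine Real.exp_le_exp.2 ?_
  have h2 : (((k + ⌊t⌋ : ℤ).natAbs : ℕ) : ℝ) = |(k : ℝ) + ⌊t⌋| := by
    rw [Nat.cast_natAbs]; push_cast; rfl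
  rw [h2]
  have h3 : |(k : ℝ) + ⌊t⌋| ≤ |k + t| + 1 := by
    have h4 : |(⌊t⌋ : ℝ) - t| ≤ 1 := by
      rw [abs_le]; constructor <;> linarith [Int.floor_le t, Int.lt_floor_add_one t]
    calc |(k : ℝ) + ⌊t⌋| = |(k + t) + (⌊t⌋ - t)| := by ring_nf
      _ ≤ _ := (abs_add_le _ _).trans (by gcongr)
  nlinarith [abs_nonneg (Real.log ρ)]

/-- Summation of a sequence between two geometric bounds: a decreasing and an increasing
one with interpolating coefficients. -/
theorem exists_tsum_rpow_le {q θ ε δ : ℝ} (hq : 0 < q) (hε : 0 < ε) (hεθ : ε < θ)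
    (hεθ' : ε < 1 - θ) (hδ : δ ≠ 0) (C : ℝ≥0) :
    ∃ C' : ℝ≥0, ∀ (x : ℕ → ℝ≥0∞) (a b : ℝ≥0∞), a ≠ ∞ → b ≠ ∞ →
      (∀ k, x k ≤ C * a ^ (1 - (θ + ε)) * b ^ (θ + ε) * 2 ^ (-(k * ε * δ))) →
      (∀ k, x k ≤ C * a ^ (1 - (θ - ε)) * b ^ (θ - ε) * 2 ^ (k * ε * δ)) →
      (∑' k, x k ^ q) ^ (1 / q) ≤ C' * a ^ (1 - θ) * b ^ θ := by
  obtain ⟨S, hS⟩ := exists_tsum_min_geometric_le (ρ := 2 ^ (-(ε * δ * q)))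
    (by positivity) (by
      intro h
      have := congrArg Real.log h
      rw [Real.log_rpow (by norm_num), Real.log_one] at this
      simp [hε.ne', hδ, hq.ne'] at this
      norm_num at this)
  refine ⟨C * S ^ (1 / q), fun x a b ha hb h₁ h₂ ↦ ?_⟩
  -- The ratio `b / a` used below needs `a, b > 0`. If one of them is zero, the first bound already
  -- kills `x`, both of its exponents being positive.
  have hzero : (∀ k, x k = 0) → (∑' k, x k ^ q) ^ (1 / q) ≤
      ↑(C * S ^ (1 / q)) * a ^ (1 - θ) * b ^ θ := by
    intro h
    simp [h, hq]
  by_cases ha0 : a = 0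
  · refine hzero fun k ↦ le_antisymm ((h₁ k).trans ?_) bot_le
    rw [ha0, ENNReal.zero_rpow_of_pos (by linarith)]; simp
  by_cases hb0 : b = 0
  · refine hzero fun k ↦ le_antisymm ((h₁ k).trans ?_) bot_le
    rw [hb0, ENNReal.zero_rpow_of_pos (by linarith)]; simp
  lift a to ℝ≥0 using ha
  lift b to ℝ≥0 using hb
  have ha' : 0 < (a : ℝ) := by
    have : a ≠ 0 := by simpa using ha0
    positivity
  have hb' : 0 < (b : ℝ) := by
    have : b ≠ 0 := by simpa using hb0
    positivity
  -- Relative to `M = C a^{1-θ} b^θ`, the two bounds are reciprocal factors `(b/a)^ε 2^{-kεδ}` and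
  -- its inverse; their `q`-th powers are `R ρ^k` and `(R ρ^k)⁻¹`.
  set R : ℝ := ((b : ℝ) / a) ^ (ε * q) with hR
  have hR0 : 0 < R := by positivity
  set M : ℝ≥0∞ := C * a ^ (1 - θ) * b ^ θ with hM
  have conv : ∀ (c : ℝ≥0) (y : ℝ), 0 < (c : ℝ) → (c : ℝ≥0∞) ^ y = ENNReal.ofReal ((c : ℝ) ^ y) := by
    intro c y hc
    rw [← ENNReal.ofReal_rpow_of_pos hc, ENNReal.ofReal_coe_nnreal]
  have conv2 : ∀ y : ℝ, (2 : ℝ≥0∞) ^ y = ENNReal.ofReal ((2 : ℝ) ^ y) := by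
    intro y
    rw [← ENNReal.ofReal_rpow_of_pos (by norm_num)]; simp
  have hMr : M = C * ENNReal.ofReal ((a : ℝ) ^ (1 - θ) * (b : ℝ) ^ θ) := by
    rw [hM, conv _ _ ha', conv _ _ hb', mul_assoc, ENNReal.ofReal_mul (by positivity)]
  set ρ : ℝ := (2 : ℝ) ^ (-(ε * δ * q)) with hρ
  have hRk : ∀ k : ℕ, (R * ρ ^ k) = (((b : ℝ) / a) ^ ε * 2 ^ (-(k * ε * δ))) ^ q := by
    intro k
    rw [Real.mul_rpow (by positivity) (by positivity), hR, hρ, ← Real.rpow_mul (by positivity),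
      ← Real.rpow_mul (by positivity), ← Real.rpow_natCast, ← Real.rpow_mul (by positivity)]
    ring_nf
  have hx : ∀ k, x k ^ q ≤ M ^ q * ENNReal.ofReal (min (R * ρ ^ k) (R * ρ ^ k)⁻¹) := by
    intro k
    have e1 : x k ≤ M * ENNReal.ofReal (((b : ℝ) / a) ^ ε * 2 ^ (-(k * ε * δ))) := by
      refine (h₁ k).trans (le_of_eq ?_)
      rw [conv _ _ ha', conv _ _ hb', conv2, hMr, mul_assoc (C : ℝ≥0∞), mul_assoc (C : ℝ≥0∞), mul_assoc (C : ℝ≥0∞),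
        ← ENNReal.ofReal_mul (by positivity), ← ENNReal.ofReal_mul (by positivity),
        ← ENNReal.ofReal_mul (by positivity)]
      congr 2
      rw [← sub_sub, Real.rpow_sub ha', Real.rpow_add hb', Real.div_rpow hb'.le ha'.le]
      field_simp
    have e2 : x k ≤ M * ENNReal.ofReal (((b : ℝ) / a) ^ ε * 2 ^ (-(k * ε * δ)))⁻¹ := by
      refine (h₂ k).trans (le_of_eq ?_)
      rw [conv _ _ ha', conv _ _ hb', conv2, hMr, mul_assoc (C : ℝ≥0∞), mul_assoc (C : ℝ≥0∞), mul_assoc (C : ℝ≥0∞),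
        ← ENNReal.ofReal_mul (by positivity), ← ENNReal.ofReal_mul (by positivity),
        ← ENNReal.ofReal_mul (by positivity)]
      congr 2
      rw [show 1 - (θ - ε) = 1 - θ + ε by ring, Real.rpow_add ha', Real.rpow_sub hb',
        Real.div_rpow hb'.le ha'.le, Real.rpow_neg (by norm_num)]
      field_simp
    rw [hRk, ← Real.inv_rpow (by positivity)]
    rcases min_cases ((((b : ℝ) / a) ^ ε * 2 ^ (-(k * ε * δ))) ^ q)
      ((((b : ℝ) / a) ^ ε * 2 ^ (-(k * ε * δ)))⁻¹ ^ q) with h | h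
    · rw [h.1, ← ENNReal.ofReal_rpow_of_nonneg (by positivity) hq.le,
        ← ENNReal.mul_rpow_of_nonneg _ _ hq.le]
      exact ENNReal.rpow_le_rpow e1 hq.le
    · rw [h.1, ← ENNReal.ofReal_rpow_of_nonneg (by positivity) hq.le,
        ← ENNReal.mul_rpow_of_nonneg _ _ hq.le]
      exact ENNReal.rpow_le_rpow e2 hq.le
  calc (∑' k, x k ^ q) ^ (1 / q) ≤ (M ^ q * S) ^ (1 / q) := by
        refine ENNReal.rpow_le_rpow ?_ (by positivity)
        refine (ENNReal.tsum_le_tsum hx).trans ?_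
        rw [ENNReal.tsum_mul_left]
        gcongr
        exact hS R hR0
    _ = _ := by
        rw [ENNReal.mul_rpow_of_nonneg _ _ (by positivity), ← ENNReal.rpow_mul,
          mul_one_div_cancel hq.ne', ENNReal.rpow_one, hM, ENNReal.coe_mul,
          ENNReal.coe_rpow_of_nonneg _ (by positivity)]
        ring

end Besov


/-! ### Schwartz kernels, Fourier multipliers and tempered functions -/

namespace Besov

open scoped FourierTransform

section SchwartzKernel

variable {E : Type*} [NormedAddCommGroup E]

theorem one_add_mul_norm_le_mul {δ : ℝ} (hδ₀ : 0 ≤ δ) (hδ₁ : δ ≤ 1) (x y : E) :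
    1 + δ * ‖y‖ ≤ (1 + δ * ‖x‖) * (1 + ‖x - y‖) := by
  have h : ‖y‖ ≤ ‖x‖ + ‖x - y‖ := by
    simpa [norm_sub_rev] using norm_sub_le x (x - y)
  have h1 : δ * ‖y‖ ≤ δ * ‖x‖ + δ * ‖x - y‖ := by
    rw [← mul_add]
    gcongr
  have h2 : δ * ‖x - y‖ ≤ ‖x - y‖ := mul_le_of_le_one_left (norm_nonneg _) hδ₁
  nlinarith [mul_nonneg (mul_nonneg hδ₀ (norm_nonneg x)) (norm_nonneg (x - y))]

variable [NormedSpace ℝ E]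

theorem exists_one_add_norm_pow_mul_le (K : 𝓢(E, ℂ)) (N : ℕ) :
    ∃ C : ℝ, 0 ≤ C ∧ ∀ z, (1 + ‖z‖) ^ N * ‖K z‖ ≤ C := by
  refine ⟨_, ?_, fun z ↦ by
    simpa using SchwartzMap.one_add_le_sup_seminorm_apply (𝕜 := ℂ) (m := (N, 0))
      (le_refl N) (le_refl 0) K z⟩
  positivity

/-- The weight `(1 + δ|x|)^N` varies slowly at unit scale, so the decay of `K` absorbs its change
from `x` to `y`. The constant is the same for all `δ ∈ [0, 1]`, which allows `δ` to depend on the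
point later. -/
theorem norm_kernel_le {K : 𝓢(E, ℂ)} {N : ℕ} {C δ : ℝ}
    (hC : ∀ z, (1 + ‖z‖) ^ N * ‖K z‖ ≤ C) (hδ₀ : 0 ≤ δ) (hδ₁ : δ ≤ 1) (x y : E) :
    ‖K (x - y)‖ ≤ C * ((1 + δ * ‖x‖) ^ N * ((1 + δ * ‖y‖) ^ N)⁻¹) := by
  have h1 := hC (x - y)
  have h2 : (1 + δ * ‖y‖) ^ N ≤ (1 + δ * ‖x‖) ^ N * (1 + ‖x - y‖) ^ N := by
    rw [← mul_pow]
    gcongr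
    exact one_add_mul_norm_le_mul hδ₀ hδ₁ x y
  rw [← mul_assoc, ← div_eq_mul_inv, le_div_iff₀ (by positivity)]
  calc ‖K (x - y)‖ * (1 + δ * ‖y‖) ^ N
      ≤ ‖K (x - y)‖ * ((1 + δ * ‖x‖) ^ N * (1 + ‖x - y‖) ^ N) := by gcongr
    _ = (1 + δ * ‖x‖) ^ N * ((1 + ‖x - y‖) ^ N * ‖K (x - y)‖) := by ring
    _ ≤ (1 + δ * ‖x‖) ^ N * C := by gcongr
    _ = _ := mul_comm _ _

end SchwartzKernel

section Fourier

variable {E : Type*} [NormedAddCommGroup E] [InnerProductSpace ℝ E] [FiniteDimensional ℝ E]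
  [MeasurableSpace E] [BorelSpace E]

/-- This is the transpose of a Fourier multiplier acting on a test function. The product becomes a
convolution on the Fourier side, and the reflections come from `𝓕 f(z) = 𝓕⁻ f(-z)`. -/
theorem fourier_smulLeftCLM_fourierInv_apply (χ φ : 𝓢(E, ℂ)) (y : E) :
    𝓕 (SchwartzMap.smulLeftCLM ℂ χ (𝓕⁻ φ)) y = ∫ x, φ x * (𝓕⁻ χ : 𝓢(E, ℂ)) (x - y) := by
  have hneg : ∀ (f : 𝓢(E, ℂ)) (z : E), 𝓕 f z = 𝓕⁻ f (-z) := by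
    intro f z
    rw [SchwartzMap.fourier_coe, SchwartzMap.fourierInv_coe, Real.fourierInv_eq_fourier_neg,
      neg_neg]
  have hconv : SchwartzMap.smulLeftCLM ℂ χ (𝓕⁻ φ) =
      𝓕 (SchwartzMap.convolution (ContinuousLinearMap.mul ℂ ℂ) (𝓕⁻ χ) (𝓕⁻ (𝓕⁻ φ))) := by
    ext z
    rw [SchwartzMap.fourier_convolution]
    simp [SchwartzMap.smulLeftCLM_apply_apply χ.hasTemperateGrowth]
  rw [hneg, hconv, FourierTransform.fourierInv_fourier_eq, SchwartzMap.convolution_apply,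
    convolution]
  simp only [ContinuousLinearMap.mul_apply']
  rw [← integral_sub_right_eq_self _ y]
  refine integral_congr_ae (.of_forall fun x ↦ ?_)
  have : (𝓕⁻ (𝓕⁻ φ) : 𝓢(E, ℂ)) (-y - (x - y)) = φ x := by
    have := hneg (𝓕⁻ φ) x
    rw [FourierTransform.fourier_fourierInv_eq] at this
    rw [this]
    congr 1
    abel
  simp only [this, mul_comm]

end Fourier

section IsGivenBy

variable {n : ℕ} {T : 𝓢'(EuclideanSpace ℝ (Fin n), ℂ)} {g g' : EuclideanSpace ℝ (Fin n) → ℂ}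

theorem smul_eq_of_weight {N : ℕ} :
    g = fun x ↦ ((1 + ‖x‖) ^ N : ℝ) • (((1 + ‖x‖) ^ N)⁻¹ • g x) := by
  ext x
  rw [smul_smul, mul_inv_cancel₀ (by positivity), one_smul]

theorem IsGivenBy.aestronglyMeasurable (h : IsGivenBy T g) : AEStronglyMeasurable g := by
  obtain ⟨⟨N, hN⟩, -⟩ := h
  rw [smul_eq_of_weight (g := g) (N := N)]
  exact (by fun_prop : Continuous fun x : EuclideanSpace ℝ (Fin n) ↦
    (1 + ‖x‖) ^ N).aestronglyMeasurable.smul hN.1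

theorem IsGivenBy.locallyIntegrable (h : IsGivenBy T g) : LocallyIntegrable g := by
  obtain ⟨⟨N, hN⟩, -⟩ := h
  rw [smul_eq_of_weight (g := g) (N := N)]
  exact (hN.locallyIntegrable).continuous_smul (by fun_prop)

theorem IsGivenBy.ae_eq (h : IsGivenBy T g) (h' : IsGivenBy T g') : g =ᵐ[volume] g' := by
  refine ae_eq_of_integral_contDiff_smul_eq h.locallyIntegrable h'.locallyIntegrable
    fun f hf hc ↦ ?_
  have hc' : HasCompactSupport fun x ↦ (f x : ℂ) := hc.comp_left (g := ((↑) : ℝ → ℂ)) (by simp)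
  have hf' : ContDiff ℝ ((⊤ : ℕ∞) : WithTop ℕ∞) fun x ↦ (f x : ℂ) := Complex.ofRealCLM.contDiff.comp hf
  have := (h.2 (hc'.toSchwartzMap hf')).symm.trans (h'.2 (hc'.toSchwartzMap hf'))
  simpa using this

/-- The kernel bound with `δ = 1` dominates the integrand by a product of integrable functions of
the two variables. It serves both Fubini's theorem and the temperedness of the convolution. -/
theorem integrable_mul_kernel {N : ℕ} (hg : Integrable fun x ↦ ((1 + ‖x‖) ^ N)⁻¹ • g x)
    {f : EuclideanSpace ℝ (Fin n) → ℂ} (hf : AEStronglyMeasurable f)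
    (hf' : Integrable fun x ↦ (1 + ‖x‖) ^ N * ‖f x‖)
    (K : 𝓢(EuclideanSpace ℝ (Fin n), ℂ)) :
    Integrable (fun z : EuclideanSpace ℝ (Fin n) × EuclideanSpace ℝ (Fin n) ↦
      f z.1 * (g z.2 * K (z.1 - z.2))) (volume.prod volume) := by
  obtain ⟨C, -, hC⟩ := exists_one_add_norm_pow_mul_le K N
  have hgm : AEStronglyMeasurable g := by
    rw [smul_eq_of_weight (g := g) (N := N)]
    exact (by fun_prop : Continuous fun x : EuclideanSpace ℝ (Fin n) ↦
      (1 + ‖x‖) ^ N).aestronglyMeasurable.smul hg.1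
  refine ((hf'.mul_prod hg.norm).const_mul C).mono' ?_ (.of_forall fun z ↦ ?_)
  · refine hf.comp_fst.mul (hgm.comp_snd.mul ?_)
    exact (K.continuous.comp (by fun_prop)).aestronglyMeasurable
  · rw [norm_mul, norm_mul, norm_smul, norm_inv, norm_pow,
      Real.norm_of_nonneg (show 0 ≤ 1 + ‖z.2‖ by positivity)]
    calc ‖f z.1‖ * (‖g z.2‖ * ‖K (z.1 - z.2)‖)
        ≤ ‖f z.1‖ * (‖g z.2‖ * (C * ((1 + ‖z.1‖) ^ N * ((1 + ‖z.2‖) ^ N)⁻¹))) := by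
          gcongr
          simpa using norm_kernel_le hC zero_le_one le_rfl z.1 z.2
      _ = _ := by ring

/-- A Fourier multiplier with Schwartz symbol acts on tempered functions by convolution. -/
theorem IsGivenBy.fourierMultiplier (h : IsGivenBy T g) (χ : 𝓢(EuclideanSpace ℝ (Fin n), ℂ)) :
    IsGivenBy (TemperedDistribution.fourierMultiplierCLM ℂ χ T)
      (fun x ↦ ∫ y, g y * (𝓕⁻ χ : 𝓢(EuclideanSpace ℝ (Fin n), ℂ)) (x - y)) := by
  obtain ⟨⟨N, hN⟩, hT⟩ := h
  set K : 𝓢(EuclideanSpace ℝ (Fin n), ℂ) := 𝓕⁻ χ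
  have hint : Integrable (fun x : EuclideanSpace ℝ (Fin n) ↦ ((1 + ‖x‖) ^ (n + 1))⁻¹) := by
    have := integrable_one_add_norm (E := EuclideanSpace ℝ (Fin n)) (μ := volume)
      (r := ((n + 1 : ℕ) : ℝ)) (by simp)
    simpa [Real.rpow_neg, Real.rpow_natCast, add_nonneg, -Nat.cast_add] using this
  -- The power `N` pays for the growth from the kernel bound; the remaining `n + 1` makes the weight
  -- integrable.
  refine ⟨⟨N + (n + 1), ?_⟩, fun φ ↦ ?_⟩
  · have := (integrable_mul_kernel hN
      (f := fun x ↦ ((((1 + ‖x‖) ^ (N + (n + 1)))⁻¹ : ℝ) : ℂ))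
      (Continuous.aestronglyMeasurable (by
        refine Complex.continuous_ofReal.comp (Continuous.inv₀ (by fun_prop) fun x ↦ ?_)
        positivity)) (by
        refine hint.congr (.of_forall fun x ↦ ?_)
        have : (0 : ℝ) < 1 + ‖x‖ := by positivity
        simp only [Complex.norm_real]
        rw [Real.norm_of_nonneg (by positivity), pow_add]
        field_simp
        ring) K).integral_prod_left
    refine this.congr (.of_forall fun x ↦ ?_)
    simp only [integral_const_mul, Complex.real_smul]
  · rw [TemperedDistribution.fourierMultiplierCLM_apply_apply, hT]
    have hφ : Integrable (fun z : EuclideanSpace ℝ (Fin n) × EuclideanSpace ℝ (Fin n) ↦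
      φ z.1 * (g z.2 * K (z.1 - z.2))) (volume.prod volume) := by
      refine integrable_mul_kernel hN φ.continuous.aestronglyMeasurable ?_ K
      obtain ⟨C, -, hC⟩ := exists_one_add_norm_pow_mul_le φ (N + (n + 1))
      refine (hint.const_mul C).mono' (by
        exact Continuous.aestronglyMeasurable (by have := φ.continuous; fun_prop))
        (.of_forall fun x ↦ ?_)
      rw [← div_eq_mul_inv, le_div_iff₀ (by positivity), Real.norm_of_nonneg (by positivity)]
      calc _ = (1 + ‖x‖) ^ (N + (n + 1)) * ‖φ x‖ := by rw [pow_add]; ring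
        _ ≤ C := hC x
    simp_rw [fourier_smulLeftCLM_fourierInv_apply, ← integral_const_mul, ← integral_mul_const]
    rw [integral_integral_swap (f := fun x y ↦ φ x * (g y * K (x - y))) hφ]
    refine integral_congr_ae (.of_forall fun y ↦ ?_)
    refine integral_congr_ae (.of_forall fun x ↦ ?_)
    simp only [K]
    ring

theorem IsGivenBy.ae_eq_convolution (h : IsGivenBy T g)
    {χ : 𝓢(EuclideanSpace ℝ (Fin n), ℂ)}
    (hχ : TemperedDistribution.fourierMultiplierCLM ℂ χ T = T) :
    g =ᵐ[volume] fun x ↦ ∫ y, g y * (𝓕⁻ χ : 𝓢(EuclideanSpace ℝ (Fin n), ℂ)) (x - y) := by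
  have := h.fourierMultiplier χ
  rw [hχ] at this
  exact h.ae_eq this

end IsGivenBy

end Besov


/-! ### Nikol'skii's inequality for all exponents -/

namespace Besov

open scoped FourierTransform

/-- With `S = sup b`, the splitting `b = b^(1-r) b^r ≤ S^(1-r) a^r` gives `S ≤ S^(1-r) M ∫ a^r`, and
`S^(1-r)` cancels because `S` is finite. The a priori bound `A` serves only this finiteness and does
not enter the estimate; `b` may be a damped version of `a`. -/
theorem rpow_le_mul_lintegral_of_le_lintegral {α : Type*} [MeasurableSpace α] {μ : Measure α}
    {a b : α → ℝ≥0∞} {M A : ℝ≥0∞} {r : ℝ} (hr₀ : 0 < r) (hr₁ : r ≤ 1) (hba : ∀ x, b x ≤ a x)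
    (hA : A ≠ ∞) (hbA : ∀ x, b x ≤ A) (h : ∀ x, b x ≤ M * ∫⁻ y, b y ∂μ) (x : α) :
    b x ^ r ≤ M * ∫⁻ y, a y ^ r ∂μ := by
  set S := ⨆ x, b x with hS
  have hS' : S ≠ ∞ := ((iSup_le hbA).trans_lt hA.lt_top).ne
  have hbS : ∀ x, b x ≤ S := fun x ↦ le_iSup b x
  have hpow : ∀ t : ℝ≥0∞, t = t ^ (1 - r) * t ^ r := by
    intro t
    rw [← ENNReal.rpow_add_of_nonneg _ _ (by linarith) hr₀.le]
    simp
  have hS'' : S ^ (1 - r) ≠ ∞ := ENNReal.rpow_ne_top_of_nonneg (by linarith) hS'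
  have h1 : S ≤ S ^ (1 - r) * (M * ∫⁻ y, a y ^ r ∂μ) := by
    refine iSup_le fun x ↦ (h x).trans ?_
    rw [mul_left_comm, ← lintegral_const_mul' _ _ hS'']
    gcongr with y
    calc b y = b y ^ (1 - r) * b y ^ r := hpow _
      _ ≤ _ := by
        exact mul_le_mul' (ENNReal.rpow_le_rpow (hbS y) (by linarith))
          (ENNReal.rpow_le_rpow (hba y) hr₀.le)
  rcases eq_or_ne S 0 with h0 | h0
  · have : b x = 0 := le_antisymm (h0 ▸ hbS x) bot_le
    simp [this, hr₀]
  refine (ENNReal.rpow_le_rpow (hbS x) hr₀.le).trans ?_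
  nth_rewrite 1 [hpow S] at h1
  exact (ENNReal.mul_le_mul_iff_right (by simp [h0, hS']) hS'').1 h1

/-- Hölder applied to `a k = (a k^(1/r)) k^(1/r')` replaces Young's inequality when `r > 1`. -/
theorem le_rpow_mul_rpow_of_le_lintegral_mul {α : Type*} [MeasurableSpace α] {μ : Measure α}
    {a k : α → ℝ≥0∞} {c A B : ℝ≥0∞} {r : ℝ} (hr : 1 < r) (ha : AEMeasurable a μ)
    (hk : AEMeasurable k μ) (hA : ∀ y, k y ≤ A) (hB : ∫⁻ y, k y ∂μ ≤ B)
    (h : c ≤ ∫⁻ y, a y * k y ∂μ) :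
    c ≤ A ^ (1 / r) * B ^ (1 - 1 / r) * (∫⁻ y, a y ^ r ∂μ) ^ (1 / r) := by
  have hc : r.HolderConjugate (Real.conjExponent r) := Real.HolderConjugate.conjExponent hr
  set r' := Real.conjExponent r
  have hr0 : 0 < r := by linarith
  have hr' : 1 / r' = 1 - 1 / r := by
    have := hc.inv_add_inv_eq_one
    simp only [one_div]; linarith
  have hr'0 : 0 < r' := hc.symm.pos
  calc c ≤ ∫⁻ y, a y * k y ∂μ := h
    _ = ∫⁻ y, (fun y ↦ a y * k y ^ (1 / r)) y * (fun y ↦ k y ^ (1 / r')) y ∂μ := by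
        refine lintegral_congr fun y ↦ ?_
        simp only
        rw [mul_assoc, ← ENNReal.rpow_add_of_nonneg _ _ (by positivity) (by positivity), hr']
        simp
    _ ≤ (∫⁻ y, (a y * k y ^ (1 / r)) ^ r ∂μ) ^ (1 / r) *
          (∫⁻ y, (k y ^ (1 / r')) ^ r' ∂μ) ^ (1 / r') :=
        ENNReal.lintegral_mul_le_Lp_mul_Lq μ hc (ha.mul (hk.pow_const _)) (hk.pow_const _)
    _ ≤ (A * ∫⁻ y, a y ^ r ∂μ) ^ (1 / r) * B ^ (1 / r') := by
        gcongr
        · rw [← lintegral_const_mul'' _ (ha.pow_const _)]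
          refine lintegral_mono fun y ↦ ?_
          simp only
          rw [ENNReal.mul_rpow_of_nonneg _ _ hr0.le, ← ENNReal.rpow_mul,
            one_div_mul_cancel hr0.ne', ENNReal.rpow_one, mul_comm]
          gcongr
          exact hA y
        · refine le_trans (le_of_eq ?_) hB
          refine lintegral_congr fun y ↦ ?_
          rw [← ENNReal.rpow_mul, one_div_mul_cancel hr'0.ne', ENNReal.rpow_one]
    _ = _ := by
        rw [ENNReal.mul_rpow_of_nonneg _ _ (by positivity), hr']
        ring

variable {n : ℕ} {g : EuclideanSpace ℝ (Fin n) → ℂ}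

/-- A tempered function which is reproduced by a Schwartz kernel and lies in `L^r`, `r ≤ 1`,
is bounded. -/
theorem exists_enorm_le_of_le_lintegral {N : ℕ}
    (hg : Integrable fun x ↦ ((1 + ‖x‖) ^ N)⁻¹ • g x)
    {K : 𝓢(EuclideanSpace ℝ (Fin n), ℂ)}
    (hK : ∀ x, ‖g x‖ₑ ≤ ∫⁻ y, ‖g y‖ₑ * ‖K (x - y)‖ₑ) {r : ℝ} (hr₀ : 0 < r) (hr₁ : r ≤ 1)
    (hI : ∫⁻ y, ‖g y‖ₑ ^ r ≠ ∞) : ∃ A : ℝ≥0∞, A ≠ ∞ ∧ ∀ x, ‖g x‖ₑ ≤ A := by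
  obtain ⟨C, hC0, hC⟩ := exists_one_add_norm_pow_mul_le K N
  set J := ∫⁻ y, ‖((1 + ‖y‖) ^ N)⁻¹ • g y‖ₑ with hJ
  have hJ' : J ≠ ∞ := hg.2.ne
  set ω : ℝ → EuclideanSpace ℝ (Fin n) → ℝ≥0∞ :=
    fun δ x ↦ ENNReal.ofReal ((1 + δ * ‖x‖) ^ N)⁻¹ with hω
  have hω1 : ∀ δ, 0 ≤ δ → ∀ x, ω δ x ≤ 1 := by
    intro δ hδ x
    rw [hω, ENNReal.ofReal_le_one]
    exact inv_le_one_of_one_le₀ (one_le_pow₀ (by simp; positivity))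
  have hωK : ∀ δ, 0 ≤ δ → δ ≤ 1 → ∀ x y,
      ‖K (x - y)‖ₑ * ω δ x ≤ ENNReal.ofReal C * ω δ y := by
    intro δ h0 h1 x y
    rw [← ofReal_norm, hω, ← ENNReal.ofReal_mul (by positivity), ← ENNReal.ofReal_mul hC0]
    refine ENNReal.ofReal_le_ofReal ?_
    rw [← div_eq_mul_inv, div_le_iff₀ (by positivity)]
    exact (norm_kernel_le hC h0 h1 x y).trans (le_of_eq (by ring))
  have hb : ∀ δ, 0 ≤ δ → δ ≤ 1 → ∀ x,
      ‖g x‖ₑ * ω δ x ≤ ENNReal.ofReal C * ∫⁻ y, ‖g y‖ₑ * ω δ y := by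
    intro δ h0 h1 x
    refine (mul_le_mul_left (hK x) _).trans ?_
    rw [← lintegral_mul_const' _ _ (by simp [hω]), ← lintegral_const_mul' _ _ (by simp)]
    refine lintegral_mono fun y ↦ ?_
    simp only
    rw [mul_assoc, mul_left_comm (ENNReal.ofReal C)]
    exact mul_le_mul' le_rfl (hωK δ h0 h1 x y)
  have hgrow : ∀ x, ‖g x‖ₑ * ω 1 x ≤ ENNReal.ofReal C * J := by
    intro x
    refine (hb 1 zero_le_one le_rfl x).trans (le_of_eq ?_)
    congr 1
    refine lintegral_congr fun y ↦ ?_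
    simp only [hω]
    rw [enorm_smul, mul_comm, one_mul, Real.enorm_of_nonneg (by positivity)]
  have hωδ : ∀ δ, 0 < δ → δ ≤ 1 → ∀ x, ω δ x ≤ ENNReal.ofReal ((δ ^ N)⁻¹) * ω 1 x := by
    intro δ h0 h1 x
    rw [hω, ← ENNReal.ofReal_mul (by positivity)]
    refine ENNReal.ofReal_le_ofReal ?_
    rw [← mul_inv, ← mul_pow]
    gcongr
    nlinarith
  refine ⟨ENNReal.ofReal (2 ^ N) *
    (ENNReal.ofReal C * ∫⁻ y, ‖g y‖ₑ ^ r) ^ (1 / r), ?_, fun x ↦ ?_⟩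
  · exact ENNReal.mul_ne_top (by simp) (ENNReal.rpow_ne_top_of_nonneg (by positivity)
      (ENNReal.mul_ne_top (by simp) hI))
  -- The damped function is bounded for each `δ > 0`, and the resulting estimate does not depend on
  -- `δ`. This choice gives `1 + δ‖x‖ ≤ 2`, so at `x` the damping loses at most `2^N`.
  set δ : ℝ := (1 + ‖x‖)⁻¹ with hδ
  have hδ0 : 0 < δ := by positivity
  have hδ1 : δ ≤ 1 := inv_le_one_of_one_le₀ (by simp)
  have key := rpow_le_mul_lintegral_of_le_lintegral (μ := volume) (a := fun y ↦ ‖g y‖ₑ)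
    (b := fun y ↦ ‖g y‖ₑ * ω δ y) (M := ENNReal.ofReal C)
    (A := ENNReal.ofReal ((δ ^ N)⁻¹) * (ENNReal.ofReal C * J)) hr₀ hr₁
    (fun y ↦ mul_le_of_le_one_right bot_le (hω1 δ hδ0.le y))
    (ENNReal.mul_ne_top (by simp) (ENNReal.mul_ne_top (by simp) hJ'))
    (fun y ↦ ?_) (hb δ hδ0.le hδ1) x
  · have h2 : 1 ≤ ENNReal.ofReal (2 ^ N) * ω δ x := by
      rw [hω, ← ENNReal.ofReal_mul (by positivity), ENNReal.one_le_ofReal,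
        ← div_eq_mul_inv, one_le_div (by positivity)]
      gcongr
      have : δ * ‖x‖ ≤ 1 := by
        rw [hδ, inv_mul_le_iff₀ (by positivity)]
        linarith
      linarith
    calc ‖g x‖ₑ = ‖g x‖ₑ * 1 := (mul_one _).symm
      _ ≤ ‖g x‖ₑ * (ENNReal.ofReal (2 ^ N) * ω δ x) := by gcongr
      _ = ENNReal.ofReal (2 ^ N) * (‖g x‖ₑ * ω δ x) := by ring
      _ ≤ _ := by
        gcongr
        rw [one_div, ENNReal.le_rpow_inv_iff hr₀]
        exact key
  · calc ‖g y‖ₑ * ω δ y ≤ ‖g y‖ₑ * (ENNReal.ofReal ((δ ^ N)⁻¹) * ω 1 y) := by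
          gcongr
          exact hωδ δ hδ0 hδ1 y
      _ = ENNReal.ofReal ((δ ^ N)⁻¹) * (‖g y‖ₑ * ω 1 y) := by ring
      _ ≤ _ := by
          exact mul_le_mul' le_rfl (hgrow y)

/-- Nikol'skii's inequality for a tempered function reproduced by a Schwartz multiplier. -/
theorem IsGivenBy.eLpNorm_top_le {T : 𝓢'(EuclideanSpace ℝ (Fin n), ℂ)} (h : IsGivenBy T g)
    {χ : 𝓢(EuclideanSpace ℝ (Fin n), ℂ)}
    (hχ : TemperedDistribution.fourierMultiplierCLM ℂ χ T = T) {A B r : ℝ≥0∞}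
    (hA : ∀ x, ‖(𝓕⁻ χ : 𝓢(EuclideanSpace ℝ (Fin n), ℂ)) x‖ₑ ≤ A)
    (hB : ∫⁻ x, ‖(𝓕⁻ χ : 𝓢(EuclideanSpace ℝ (Fin n), ℂ)) x‖ₑ ≤ B) (hB₁ : 1 ≤ B)
    (hr₀ : r ≠ 0) (hr : r ≠ ∞) (hgr : eLpNorm g r volume ≠ ∞) :
    eLpNorm g ∞ volume ≤ A ^ (r⁻¹).toReal * B * eLpNorm g r volume := by
  set K : 𝓢(EuclideanSpace ℝ (Fin n), ℂ) := 𝓕⁻ χ with hK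
  -- The representative `G` satisfies the reproducing inequality at every point, not merely almost
  -- everywhere.
  set G : EuclideanSpace ℝ (Fin n) → ℂ := fun x ↦ ∫ y, g y * K (x - y) with hG
  have hgG : g =ᵐ[volume] G := h.ae_eq_convolution hχ
  have hGT : IsGivenBy T G := hχ ▸ h.fourierMultiplier χ
  have hrep : ∀ x, ‖G x‖ₑ ≤ ∫⁻ y, ‖G y‖ₑ * ‖K (x - y)‖ₑ := by
    intro x
    refine (enorm_integral_le_lintegral_enorm _).trans (le_of_eq ?_)
    refine lintegral_congr_ae ?_
    filter_upwards [hgG] with y hy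
    rw [enorm_mul, hy]
  rw [eLpNorm_congr_ae hgG] at hgr ⊢
  rw [eLpNorm_congr_ae hgG, ENNReal.toReal_inv]
  have hr' : 0 < r.toReal := ENNReal.toReal_pos hr₀ hr
  have hnorm := eLpNorm_eq_lintegral_rpow_enorm_toReal (f := G) (μ := volume) hr₀ hr
  have hI : ∫⁻ y, ‖G y‖ₑ ^ r.toReal ≠ ∞ := by
    intro hI
    rw [hnorm, hI, ENNReal.top_rpow_of_pos (by positivity)] at hgr
    exact hgr rfl
  rw [hnorm, eLpNorm_exponent_top]
  refine eLpNormEssSup_le_of_ae_enorm_bound (.of_forall fun x ↦ ?_)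
  rcases le_or_gt r.toReal 1 with hr1 | hr1
  · obtain ⟨N, hN⟩ := hGT.1
    obtain ⟨D, hD, hGD⟩ := exists_enorm_le_of_le_lintegral hN hrep hr' hr1 hI
    have hAK : ∀ x, ‖G x‖ₑ ≤ A * ∫⁻ y, ‖G y‖ₑ := by
      intro x
      refine (hrep x).trans ?_
      rw [← lintegral_const_mul'' _ hGT.aestronglyMeasurable.enorm]
      refine lintegral_mono fun y ↦ ?_
      simp only
      rw [mul_comm]
      gcongr
      exact hA _
    have key := rpow_le_mul_lintegral_of_le_lintegral (μ := volume) hr' hr1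
      (fun y ↦ le_refl ‖G y‖ₑ) hD hGD hAK x
    rw [← ENNReal.le_rpow_inv_iff hr', ENNReal.mul_rpow_of_nonneg _ _ (by positivity)] at key
    rw [one_div]
    refine key.trans ?_
    gcongr
    exact le_mul_of_one_le_right bot_le hB₁
  · have key := le_rpow_mul_rpow_of_le_lintegral_mul (μ := volume) (c := ‖G x‖ₑ)
      (a := fun y ↦ ‖G y‖ₑ) (k := fun y ↦ ‖K (x - y)‖ₑ) (A := A) (B := B) hr1
      hGT.aestronglyMeasurable.enorm
      (K.continuous.comp (by fun_prop : Continuous fun y ↦ x - y)).aestronglyMeasurable.enorm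
      (fun y ↦ hA _) (by rwa [lintegral_sub_left_eq_self (fun y ↦ ‖K y‖ₑ) x]) (hrep x)
    refine key.trans ?_
    rw [one_div]
    gcongr
    refine (ENNReal.rpow_le_rpow_of_exponent_le hB₁ (?_ : _ ≤ (1 : ℝ))).trans_eq
      (ENNReal.rpow_one _)
    have : 0 ≤ r.toReal⁻¹ := by positivity
    linarith

end Besov


/-! ### Dyadic blocks: frequency cut-offs and Bernstein's inequality -/

namespace Besov

open scoped FourierTransform

theorem fourierInv_comp_inv_smul {n : ℕ} (f : EuclideanSpace ℝ (Fin n) → ℂ) {c : ℝ} (hc : 0 < c)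
    (x : EuclideanSpace ℝ (Fin n)) :
    𝓕⁻ (fun ξ ↦ f (c⁻¹ • ξ)) x = (c ^ n : ℝ) • 𝓕⁻ f (c • x) := by
  rw [Real.fourierInv_eq, Real.fourierInv_eq]
  have := Measure.integral_comp_smul (volume : Measure (EuclideanSpace ℝ (Fin n)))
    (fun v ↦ Real.fourierChar (inner ℝ v (c • x)) • f v) c⁻¹
  rw [finrank_euclideanSpace_fin, inv_pow, inv_inv, abs_of_pos (by positivity)] at this
  rw [← this]
  refine integral_congr_ae (.of_forall fun v ↦ ?_)
  simp only
  rw [real_inner_smul_left, real_inner_smul_right, inv_mul_cancel_left₀ hc.ne']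

/-- Smooth frequency cut-offs at scale `2ᵏ` with uniformly controlled kernels. -/
theorem exists_frequency_cutoffs (n : ℕ) :
    ∃ (χ : ℕ → 𝓢(EuclideanSpace ℝ (Fin n), ℂ)) (A B : ℝ≥0), 1 ≤ B ∧
      (∀ k ξ, ‖ξ‖ ≤ 2 * 2 ^ k → χ k ξ = 1) ∧
      (∀ k x, ‖(𝓕⁻ (χ k) : 𝓢(EuclideanSpace ℝ (Fin n), ℂ)) x‖ₑ ≤ A * 2 ^ ((k : ℝ) * n)) ∧
      ∀ k, ∫⁻ x, ‖(𝓕⁻ (χ k) : 𝓢(EuclideanSpace ℝ (Fin n), ℂ)) x‖ₑ ≤ B := by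
  let f : ContDiffBump (0 : EuclideanSpace ℝ (Fin n)) := ⟨2, 3, by norm_num, by norm_num⟩
  have hsmooth : ∀ k : ℕ, ContDiff ℝ ((⊤ : ℕ∞) : WithTop ℕ∞)
      fun ξ : EuclideanSpace ℝ (Fin n) ↦ (f (((2 : ℝ) ^ k)⁻¹ • ξ) : ℂ) := fun k ↦
    Complex.ofRealCLM.contDiff.comp (f.contDiff.comp (contDiff_const_smul _))
  have hcomp : ∀ k : ℕ, HasCompactSupport
      fun ξ : EuclideanSpace ℝ (Fin n) ↦ (f (((2 : ℝ) ^ k)⁻¹ • ξ) : ℂ) := fun k ↦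
    (f.hasCompactSupport.comp_smul (by positivity)).comp_left (g := ((↑) : ℝ → ℂ)) (by simp)
  let χ : ℕ → 𝓢(EuclideanSpace ℝ (Fin n), ℂ) := fun k ↦ (hcomp k).toSchwartzMap (hsmooth k)
  let K : 𝓢(EuclideanSpace ℝ (Fin n), ℂ) := 𝓕⁻ (χ 0)
  have hK : ∀ k x, (𝓕⁻ (χ k) : 𝓢(EuclideanSpace ℝ (Fin n), ℂ)) x =
      (((2 : ℝ) ^ k) ^ n : ℝ) • K ((2 : ℝ) ^ k • x) := by
    intro k x
    simp only [K]
    have hχ : (χ k : EuclideanSpace ℝ (Fin n) → ℂ) = fun ξ ↦ χ 0 (((2 : ℝ) ^ k)⁻¹ • ξ) := by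
      ext ξ
      simp [χ]
    rw [SchwartzMap.fourierInv_coe, SchwartzMap.fourierInv_coe,
      ← fourierInv_comp_inv_smul _ (by positivity), hχ]
  obtain ⟨C, hC0, hC⟩ := exists_one_add_norm_pow_mul_le K 0
  refine ⟨χ, C.toNNReal, 1 + (∫⁻ x, ‖K x‖ₑ).toNNReal, by simp, ?_, ?_, ?_⟩
  · intro k ξ hξ
    have : f (((2 : ℝ) ^ k)⁻¹ • ξ) = 1 := by
      refine f.one_of_mem_closedBall ?_
      rw [mem_closedBall_zero_iff, norm_smul, norm_inv, norm_pow, Real.norm_ofNat,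
        inv_mul_le_iff₀ (by positivity), mul_comm]
      exact hξ
    simp [χ, this]
  · intro k x
    rw [hK, enorm_smul, mul_comm]
    gcongr
    · rw [← ofReal_norm]
      exact ENNReal.ofReal_le_ofReal (by simpa using hC ((2 : ℝ) ^ k • x))
    · rw [Real.enorm_of_nonneg (by positivity), ← pow_mul, ENNReal.ofReal_pow (by norm_num),
        ← ENNReal.rpow_natCast]
      simp
  · intro k
    have hint : ∀ L : 𝓢(EuclideanSpace ℝ (Fin n), ℂ),
        ∫⁻ x, ‖L x‖ₑ = ENNReal.ofReal (∫ x, ‖L x‖) := fun L ↦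
      (ofReal_integral_norm_eq_lintegral_enorm L.integrable).symm
    have hnorm : ∫ x, ‖(𝓕⁻ (χ k) : 𝓢(EuclideanSpace ℝ (Fin n), ℂ)) x‖ = ∫ x, ‖K x‖ := by
      simp_rw [hK, norm_smul]
      rw [integral_const_mul, Measure.integral_comp_smul volume (fun x ↦ ‖K x‖),
        finrank_euclideanSpace_fin, Real.norm_of_nonneg (by positivity),
        abs_of_nonneg (by positivity), smul_eq_mul, mul_inv_cancel_left₀ (by positivity)]
    rw [hint, hnorm, ← hint, ENNReal.coe_add, ENNReal.coe_toNNReal]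
    · exact le_add_self
    · rw [hint]; simp

variable {n : ℕ} {ψ : EuclideanSpace ℝ (Fin n) → ℝ}

theorem IsCutoff.norm_le_of_dyadic_ne_zero (hψ : IsCutoff ψ) {k : ℕ}
    {ξ : EuclideanSpace ℝ (Fin n)} (h : dyadic ψ k ξ ≠ 0) : ‖ξ‖ ≤ 2 * 2 ^ k := by
  have hsupp : ∀ ζ, ψ ζ ≠ 0 → ‖ζ‖ ≤ 2 := fun ζ hζ ↦ by
    simpa using hψ.support_subset hζ
  have hscale : ψ (((2 : ℝ) ^ k)⁻¹ • ξ) ≠ 0 → ‖ξ‖ ≤ 2 * 2 ^ k := fun h ↦ by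
    have := hsupp _ h
    rwa [norm_smul, norm_inv, norm_pow, Real.norm_ofNat, inv_mul_le_iff₀ (by positivity),
      mul_comm] at this
  unfold dyadic at h
  split_ifs at h with hk
  · simpa [hk] using hsupp _ h
  · by_cases h1 : ψ (((2 : ℝ) ^ k)⁻¹ • ξ) = 0
    · rw [h1, zero_sub, neg_ne_zero] at h
      have := hsupp _ h
      rw [norm_smul, norm_smul, norm_inv, norm_pow, Real.norm_ofNat] at this
      have h2 : ((2 : ℝ) ^ k)⁻¹ * ‖ξ‖ ≤ 2 := by
        have : 0 ≤ ((2 : ℝ) ^ k)⁻¹ * ‖ξ‖ := by positivity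
        linarith
      rwa [inv_mul_le_iff₀ (by positivity), mul_comm] at h2
    · exact hscale h1

theorem IsCutoff.hasTemperateGrowth_dyadic (hψ : IsCutoff ψ) (k : ℕ) :
    (fun ξ ↦ (dyadic ψ k ξ : ℂ)).HasTemperateGrowth := by
  have hc : HasCompactSupport fun ξ ↦ (dyadic ψ k ξ : ℂ) := by
    refine HasCompactSupport.intro (isCompact_closedBall 0 (2 * 2 ^ k)) fun ξ hξ ↦ ?_
    by_contra h
    exact hξ (by simpa using hψ.norm_le_of_dyadic_ne_zero (by simpa using h))
  refine hc.hasTemperateGrowth (Complex.ofRealCLM.contDiff.comp (f := dyadic ψ k) ?_)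
  have hs : ContDiff ℝ ((⊤ : ℕ∞) : WithTop ℕ∞) ψ := hψ.smooth
  unfold dyadic
  split_ifs
  · exact hs
  · fun_prop

/-- Since `χ = 1` on the support of `ψₖ`, the product of the symbols is `ψₖ`; this is the
reproducing formula for blocks. -/
theorem IsCutoff.fourierMultiplier_block (hψ : IsCutoff ψ) {k : ℕ}
    {χ : 𝓢(EuclideanSpace ℝ (Fin n), ℂ)} (hχ : ∀ ξ, ‖ξ‖ ≤ 2 * 2 ^ k → χ ξ = 1)
    (u : 𝓢'(EuclideanSpace ℝ (Fin n), ℂ)) :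
    TemperedDistribution.fourierMultiplierCLM ℂ χ (block ψ k u) = block ψ k u := by
  rw [block, TemperedDistribution.fourierMultiplierCLM_fourierMultiplierCLM_apply
    (hψ.hasTemperateGrowth_dyadic k) χ.hasTemperateGrowth]
  congr 2
  ext ξ
  by_cases h : dyadic ψ k ξ = 0
  · simp [h]
  · simp [hχ ξ (hψ.norm_le_of_dyadic_ne_zero h)]

theorem IsGivenBy.distLpNorm_eq {T : 𝓢'(EuclideanSpace ℝ (Fin n), ℂ)}
    {g : EuclideanSpace ℝ (Fin n) → ℂ} (h : IsGivenBy T g) (p : ℝ≥0∞) :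
    distLpNorm p T = eLpNorm g p volume :=
  le_antisymm (iInf₂_le g h) (le_iInf₂ fun _ h' ↦ (eLpNorm_congr_ae (h.ae_eq h')).le)

theorem exists_isGivenBy_of_distLpNorm_lt_top {T : 𝓢'(EuclideanSpace ℝ (Fin n), ℂ)}
    {p : ℝ≥0∞} (h : distLpNorm p T < ∞) : ∃ g, IsGivenBy T g := by
  simp only [distLpNorm, iInf_lt_iff] at h
  obtain ⟨g, hg, -⟩ := h
  exact ⟨g, hg⟩

/-- Bernstein's inequality for dyadic blocks. -/
theorem IsCutoff.exists_eLpNorm_block_le (hψ : IsCutoff ψ) {p r : ℝ≥0∞} (hp : p ≠ 0) (hr : r ≠ 0)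
    (hrp : r ≤ p) : ∃ C : ℝ≥0, ∀ (k : ℕ) (u : 𝓢'(EuclideanSpace ℝ (Fin n), ℂ))
      (g : EuclideanSpace ℝ (Fin n) → ℂ), IsGivenBy (block ψ k u) g → eLpNorm g r volume ≠ ∞ →
      eLpNorm g p volume ≤
        C * 2 ^ ((k : ℝ) * (n * ((r⁻¹).toReal - (p⁻¹).toReal))) * eLpNorm g r volume := by
  rcases eq_or_ne r ∞ with rfl | hr'
  · refine ⟨1, fun k u g _ _ ↦ ?_⟩
    simp [top_le_iff.1 hrp]
  obtain ⟨χ, A, B, hB1, hχ, hA, hB⟩ := exists_frequency_cutoffs n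
  set a := (r⁻¹).toReal with ha
  set b := (p⁻¹).toReal with hb
  have hrtop : r⁻¹ ≠ ∞ := by simpa using hr
  have hptop : p⁻¹ ≠ ∞ := by simpa using hp
  have ha0 : 0 < a := ENNReal.toReal_pos (by simpa using hr') hrtop
  have hb0 : 0 ≤ b := ENNReal.toReal_nonneg
  have hba : b ≤ a := ENNReal.toReal_mono hrtop (ENNReal.inv_le_inv.2 hrp)
  -- Chosen so that `1/p = (1 - η)/r + η/∞`: `L^p` is interpolated between `L^r` and the `L^∞` bound
  -- of Nikol'skii.
  set η : ℝ := 1 - b / a with hη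
  have hη0 : 0 ≤ η := sub_nonneg.2 (div_le_one_of_le₀ hba ha0.le)
  have hη1 : η ≤ 1 := sub_le_self _ (by positivity)
  have haη : a * η = a - b := by
    rw [hη]; field_simp
  refine ⟨A ^ (a - b) * B ^ η, fun k u g hg hgr ↦ ?_⟩
  have hinf := hg.eLpNorm_top_le (hψ.fourierMultiplier_block (hχ k) u) (hA k) (hB k)
    (by exact_mod_cast hB1) hr hr' hgr
  refine (eLpNorm_le_rpow_mul_rpow hg.aestronglyMeasurable (p := r) (q := ∞) hη0 hη1 ?_).trans ?_
  · rw [ENNReal.inv_top, mul_zero, add_zero, ← ENNReal.ofReal_toReal hrtop,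
      ← ENNReal.ofReal_toReal hptop, ← ha, ← hb, ← ENNReal.ofReal_mul (by linarith)]
    congr 1
    rw [hη, sub_sub_cancel, div_mul_cancel₀ _ ha0.ne']
  · refine (mul_le_mul' le_rfl (ENNReal.rpow_le_rpow hinf hη0)).trans (le_of_eq ?_)
    have hX : eLpNorm g r volume =
        eLpNorm g r volume ^ (1 - η) * eLpNorm g r volume ^ η := by
      rw [← ENNReal.rpow_add_of_nonneg _ _ (by linarith) hη0]
      simp
    conv_rhs => rw [hX]
    rw [ENNReal.mul_rpow_of_nonneg _ _ hη0, ENNReal.mul_rpow_of_nonneg _ _ hη0,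
      ← ENNReal.rpow_mul, ← ha, haη, ENNReal.mul_rpow_of_nonneg _ _ (sub_nonneg.2 hba),
      ← ENNReal.rpow_mul, ENNReal.coe_mul, ENNReal.coe_rpow_of_nonneg _ (sub_nonneg.2 hba),
      ENNReal.coe_rpow_of_nonneg _ hη0, mul_assoc (k : ℝ)]
    ring

/-- Interpolation between two integrability exponents, followed by Bernstein's inequality. -/
theorem IsCutoff.exists_distLpNorm_block_le (hψ : IsCutoff ψ) {p p₀ p₁ : ℝ≥0∞} (hp : p ≠ 0)
    (hp₀ : p₀ ≠ 0) (hp₁ : p₁ ≠ 0) {η : ℝ} (hη₀ : 0 ≤ η) (hη₁ : η ≤ 1)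
    (h : (p⁻¹).toReal ≤ (1 - η) * (p₀⁻¹).toReal + η * (p₁⁻¹).toReal) :
    ∃ C : ℝ≥0, ∀ (k : ℕ) (u : 𝓢'(EuclideanSpace ℝ (Fin n), ℂ)),
      distLpNorm p₀ (block ψ k u) < ∞ → distLpNorm p₁ (block ψ k u) < ∞ →
      distLpNorm p (block ψ k u) ≤ C * 2 ^ ((k : ℝ) * (n *
        ((1 - η) * (p₀⁻¹).toReal + η * (p₁⁻¹).toReal - (p⁻¹).toReal))) *
        (distLpNorm p₀ (block ψ k u) ^ (1 - η) * distLpNorm p₁ (block ψ k u) ^ η) := by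
  have hp₀' : p₀⁻¹ ≠ ∞ := by simpa using hp₀
  have hp₁' : p₁⁻¹ ≠ ∞ := by simpa using hp₁
  have hp' : p⁻¹ ≠ ∞ := by simpa using hp
  set i := ENNReal.ofReal (1 - η) * p₀⁻¹ + ENNReal.ofReal η * p₁⁻¹ with hi
  have hitop : i ≠ ∞ := ENNReal.add_ne_top.2
    ⟨ENNReal.mul_ne_top (by simp) hp₀', ENNReal.mul_ne_top (by simp) hp₁'⟩
  have hireal : i.toReal = (1 - η) * (p₀⁻¹).toReal + η * (p₁⁻¹).toReal := by
    rw [hi, ENNReal.toReal_add (ENNReal.mul_ne_top (by simp) hp₀')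
      (ENNReal.mul_ne_top (by simp) hp₁'), ENNReal.toReal_mul, ENNReal.toReal_mul,
      ENNReal.toReal_ofReal (by linarith), ENNReal.toReal_ofReal hη₀]
  have hip : i⁻¹ ≤ p := by
    rw [ENNReal.inv_le_iff_inv_le, ← ENNReal.toReal_le_toReal hp' hitop, hireal]
    exact h
  obtain ⟨C, hC⟩ := hψ.exists_eLpNorm_block_le hp (ENNReal.inv_ne_zero.2 hitop) hip
  refine ⟨C, fun k u h₀ h₁ ↦ ?_⟩
  -- One representative computes the norms for all three exponents, as it is unique almost
  -- everywhere.
  obtain ⟨g, hg⟩ := exists_isGivenBy_of_distLpNorm_lt_top h₀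
  simp only [hg.distLpNorm_eq] at h₀ h₁ ⊢
  have hint := eLpNorm_le_rpow_mul_rpow hg.aestronglyMeasurable (p := p₀) (q := p₁) (r := i⁻¹)
    hη₀ hη₁ (by rw [inv_inv])
  have hfin : eLpNorm g i⁻¹ volume ≠ ∞ := by
    refine (hint.trans_lt (ENNReal.mul_lt_top ?_ ?_)).ne
    · exact ENNReal.rpow_lt_top_of_nonneg (by linarith) h₀.ne
    · exact ENNReal.rpow_lt_top_of_nonneg hη₀ h₁.ne
  have := hC k u g hg hfin
  rw [inv_inv, hireal] at this
  exact this.trans (mul_le_mul' le_rfl hint)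

theorem two_rpow_mul_distLpNorm_le_besovNorm (s : ℝ) (p : ℝ≥0∞)
    (u : 𝓢'(EuclideanSpace ℝ (Fin n), ℂ)) (k : ℕ) :
    (2 : ℝ≥0∞) ^ ((k : ℝ) * s) * distLpNorm p (block ψ k u) ≤ besovNorm ψ s p ∞ u := by
  rw [besovNorm, if_pos rfl]
  exact le_iSup (fun k : ℕ ↦ (2 : ℝ≥0∞) ^ ((k : ℝ) * s) * distLpNorm p (block ψ k u)) k

theorem distLpNorm_block_le (s : ℝ) (p : ℝ≥0∞)
    (u : 𝓢'(EuclideanSpace ℝ (Fin n), ℂ)) (k : ℕ) :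
    distLpNorm p (block ψ k u) ≤ (2 : ℝ≥0∞) ^ (-((k : ℝ) * s)) * besovNorm ψ s p ∞ u := by
  have h := two_rpow_mul_distLpNorm_le_besovNorm (ψ := ψ) s p u k
  calc distLpNorm p (block ψ k u)
      = 2 ^ (-((k : ℝ) * s)) * (2 ^ ((k : ℝ) * s) * distLpNorm p (block ψ k u)) := by
        rw [← mul_assoc, ← ENNReal.rpow_add _ _ (by simp) (by simp)]
        simp
    _ ≤ _ := mul_le_mul' le_rfl h

theorem distLpNorm_block_lt_top {s : ℝ} {p : ℝ≥0∞} {u : 𝓢'(EuclideanSpace ℝ (Fin n), ℂ)}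
    (hu : MemBesov ψ s p ∞ u) (k : ℕ) : distLpNorm p (block ψ k u) < ∞ :=
  (distLpNorm_block_le s p u k).trans_lt
    (ENNReal.mul_lt_top (by simp [lt_top_iff_ne_top, ENNReal.rpow_eq_top_iff]) hu)

/-- Bound of a single weighted block by interpolated Besov norms. -/
theorem IsCutoff.exists_weighted_block_le (hψ : IsCutoff ψ) {p p₀ p₁ : ℝ≥0∞} (hp : p ≠ 0)
    (hp₀ : p₀ ≠ 0) (hp₁ : p₁ ≠ 0) {η : ℝ} (hη₀ : 0 ≤ η) (hη₁ : η ≤ 1)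
    (h : (p⁻¹).toReal ≤ (1 - η) * (p₀⁻¹).toReal + η * (p₁⁻¹).toReal) (s s₀ s₁ : ℝ) :
    ∃ C : ℝ≥0, ∀ u : 𝓢'(EuclideanSpace ℝ (Fin n), ℂ),
      MemBesov ψ s₀ p₀ ∞ u → MemBesov ψ s₁ p₁ ∞ u → ∀ k : ℕ,
      (2 : ℝ≥0∞) ^ ((k : ℝ) * s) * distLpNorm p (block ψ k u) ≤
        C * besovNorm ψ s₀ p₀ ∞ u ^ (1 - η) * besovNorm ψ s₁ p₁ ∞ u ^ η *
        2 ^ ((k : ℝ) * ((1 - η) * (n * (p₀⁻¹).toReal - s₀) + η * (n * (p₁⁻¹).toReal - s₁) -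
          (n * (p⁻¹).toReal - s))) := by
  obtain ⟨C, hC⟩ := hψ.exists_distLpNorm_block_le hp hp₀ hp₁ hη₀ hη₁ h
  refine ⟨C, fun u h₀ h₁ k ↦ ?_⟩
  have hη : 0 ≤ 1 - η := by linarith
  have e₀ := ENNReal.rpow_le_rpow (distLpNorm_block_le (ψ := ψ) s₀ p₀ u k) hη
  have e₁ := ENNReal.rpow_le_rpow (distLpNorm_block_le (ψ := ψ) s₁ p₁ u k) hη₀
  rw [ENNReal.mul_rpow_of_nonneg _ _ hη, ← ENNReal.rpow_mul] at e₀
  rw [ENNReal.mul_rpow_of_nonneg _ _ hη₀, ← ENNReal.rpow_mul] at e₁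
  refine (mul_le_mul' le_rfl ((hC k u (distLpNorm_block_lt_top h₀ k)
    (distLpNorm_block_lt_top h₁ k)).trans (mul_le_mul' le_rfl (mul_le_mul' e₀ e₁)))).trans
    (le_of_eq ?_)
  have hexp : (k : ℝ) * ((1 - η) * (n * (p₀⁻¹).toReal - s₀) + η * (n * (p₁⁻¹).toReal - s₁) -
      (n * (p⁻¹).toReal - s)) = k * s + (k * (n *
        ((1 - η) * (p₀⁻¹).toReal + η * (p₁⁻¹).toReal - (p⁻¹).toReal)) +
        (-(k * s₀) * (1 - η) + -(k * s₁) * η)) := by ring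
  rw [hexp, ENNReal.rpow_add _ _ (by simp) (by simp), ENNReal.rpow_add _ _ (by simp) (by simp),
    ENNReal.rpow_add _ _ (by simp) (by simp)]
  ring

end Besov

/-! ### The interpolation inequality -/

theorem theorem4p1 (n : ℕ) (hn : 1 ≤ n)
    (ψ : EuclideanSpace ℝ (Fin n) → ℝ) (hψ : Besov.IsCutoff ψ)
    (p p₀ p₁ q : ℝ≥0∞) (s s₀ s₁ θ : ℝ)
    (hq : 0 < q) (hq' : q < ∞) (hp : 0 < p) (hp₀ : 0 < p₀) (hp₁ : 0 < p₁)
    (hθ : 0 < θ) (hθ' : θ < 1)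
    (hscale : n * (p⁻¹).toReal - s =
      (1 - θ) * (n * (p₀⁻¹).toReal - s₀) + θ * (n * (p₁⁻¹).toReal - s₁))
    (hne : s₀ - n * (p₀⁻¹).toReal ≠ s₁ - n * (p₁⁻¹).toReal)
    (hs : s ≤ (1 - θ) * s₀ + θ * s₁)
    (heq : s = (1 - θ) * s₀ + θ * s₁ → p₀ = p₁) :
    ∃ C : ℝ≥0, ∀ u : 𝓢'(EuclideanSpace ℝ (Fin n), ℂ),
      Besov.MemBesov ψ s₀ p₀ ∞ u → Besov.MemBesov ψ s₁ p₁ ∞ u →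
        Besov.MemBesov ψ s p q u ∧
        Besov.besovNorm ψ s p q u ≤
          C * Besov.besovNorm ψ s₀ p₀ ∞ u ^ (1 - θ) * Besov.besovNorm ψ s₁ p₁ ∞ u ^ θ := by
  have hn' : (0 : ℝ) < n := by exact_mod_cast hn
  set a := (p⁻¹).toReal with ha
  set a₀ := (p₀⁻¹).toReal with ha₀
  set a₁ := (p₁⁻¹).toReal with ha₁
  obtain ⟨ε, hε, hεθ, hεθ', hup, hlow⟩ : ∃ ε : ℝ, 0 < ε ∧ ε < θ ∧ ε < 1 - θ ∧
      a ≤ (1 - (θ + ε)) * a₀ + (θ + ε) * a₁ ∧ a ≤ (1 - (θ - ε)) * a₀ + (θ - ε) * a₁ := by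
    have hdef : n * ((1 - θ) * a₀ + θ * a₁ - a) = (1 - θ) * s₀ + θ * s₁ - s := by
      linear_combination -hscale
    have hm : 0 < min θ (1 - θ) / 2 := by
      have : 0 < min θ (1 - θ) := lt_min hθ (by linarith)
      positivity
    have hm1 : min θ (1 - θ) ≤ θ := min_le_left _ _
    have hm2 : min θ (1 - θ) ≤ 1 - θ := min_le_right _ _
    -- The slack `(1-θ)a₀ + θa₁ - a` is `1/n` times the slack in the condition on `s`. If it is
    -- zero, `a = a₀ = a₁` and any small `ε` works; otherwise `ε |a₁ - a₀|` has to stay below it.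
    rcases hs.eq_or_lt with h | h
    · have h01 : a₀ = a₁ := by rw [ha₀, ha₁, heq h]
      have hz : (1 - θ) * a₀ + θ * a₁ - a = 0 := by
        rw [h, sub_self] at hdef
        exact (mul_eq_zero.1 hdef).resolve_left hn'.ne'
      rw [← h01] at hz ⊢
      exact ⟨min θ (1 - θ) / 2, hm, by linarith, by linarith, by linarith, by linarith⟩
    · have hz : 0 < (1 - θ) * a₀ + θ * a₁ - a := by
        have : 0 < n * ((1 - θ) * a₀ + θ * a₁ - a) := by rw [hdef]; linarith
        exact (mul_pos_iff_of_pos_left hn').1 this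
      set d := (1 - θ) * a₀ + θ * a₁ - a with hd
      set ε := min (min θ (1 - θ) / 2) (d / (|a₁ - a₀| + 1)) with hε
      have hε0 : 0 < ε := lt_min hm (by positivity)
      have hε1 : ε ≤ min θ (1 - θ) / 2 := min_le_left _ _
      have hε2 : ε * (|a₁ - a₀| + 1) ≤ d := (le_div_iff₀ (by positivity)).1 (min_le_right _ _)
      have h1 : ε * (a₁ - a₀) ≤ ε * |a₁ - a₀| := by gcongr; exact le_abs_self _
      have h2 : ε * -(a₁ - a₀) ≤ ε * |a₁ - a₀| := by gcongr; exact neg_le_abs _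
      exact ⟨ε, hε0, by linarith, by linarith, by linarith, by linarith⟩
  obtain ⟨C₁, hC₁⟩ := hψ.exists_weighted_block_le hp.ne' hp₀.ne' hp₁.ne'
    (by linarith) (by linarith) hup s s₀ s₁
  obtain ⟨C₂, hC₂⟩ := hψ.exists_weighted_block_le hp.ne' hp₀.ne' hp₁.ne'
    (by linarith) (by linarith) hlow s s₀ s₁
  obtain ⟨C, hC⟩ := Besov.exists_tsum_rpow_le (ENNReal.toReal_pos hq.ne' hq'.ne) hε hεθ hεθ'
    (δ := (s₁ - n * a₁) - (s₀ - n * a₀)) (sub_ne_zero.2 hne.symm) (max C₁ C₂)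
  refine ⟨C, fun u h₀ h₁ ↦ ?_⟩
  have key : Besov.besovNorm ψ s p q u ≤
      C * Besov.besovNorm ψ s₀ p₀ ∞ u ^ (1 - θ) * Besov.besovNorm ψ s₁ p₁ ∞ u ^ θ := by
    rw [Besov.besovNorm, if_neg hq'.ne]
    refine hC _ _ _ h₀.ne h₁.ne (fun k ↦ (hC₁ u h₀ h₁ k).trans ?_)
      (fun k ↦ (hC₂ u h₀ h₁ k).trans ?_)
    · refine mul_le_mul' ?_ (le_of_eq ?_)
      · gcongr
        exact le_max_left _ _
      · congr 1
        -- Subtracting the scaling relation leaves only the part of the exponent proportional to `η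
        -- - θ`, namely `-(η - θ)δ`.
        linear_combination -(k : ℝ) * hscale
    · refine mul_le_mul' ?_ (le_of_eq ?_)
      · gcongr
        exact le_max_right _ _
      · congr 1
        linear_combination -(k : ℝ) * hscale
  refine ⟨key.trans_lt (ENNReal.mul_lt_top (ENNReal.mul_lt_top (by simp) ?_) ?_), key⟩
  · exact ENNReal.rpow_lt_top_of_nonneg (by linarith) h₀.ne
  · exact ENNReal.rpow_lt_top_of_nonneg hθ.le h₁.ne
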